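/- Let $X$ be a countable set, $\phi\colon X\to X$, $(W,\mathscr A,\varrho)$ a $\sigma$-finite measure space and $\{\lambda_x\}_{x\in X}$ a family of $\mathscr A$-measurable functions $W\to\mathbb C$. Let $(S,\varSigma)$ be a measurable space and $\{\vartheta_x^w\colon x\in X,\ w\in W\}$ a family of probability measures on $\varSigma$ such that (A) $w\mapsto\vartheta_x^w(\sigma)$ is $\mathscr A$-measurable for all $x\in X$, $\sigma\in\varSigma$, and (B) $|\lambda_x(w)|^2\vartheta_x^w\ll\vartheta_{\phi(x)}^w$ for all $x\in X$, $w\in W$. For $x\in X$ let $\widehat\varrho_x$ be the measure on $\mathscr A\otimes\varSigma$ given by $\widehat\varrho_x(E)=\int_W\int_S\chi_E(w,s)\,d\vartheta_x^w(s)\,d\varrho(w)$, let $\widehat\lambda_x(w,s)=\lambda_x(w)$ (then $|\widehat\lambda_x|^2\widehat\varrho_x\ll\widehat\varrho_{\phi(x)}$), and let $$\mathsf G_x=\sum_{y\in\phi^{-1}(\{x\})}\frac{d\,|\widehat\lambda_y|^2\widehat\varrho_y}{d\,\widehat\varrho_x}\colon W\times S\to[0,\infty]\qquad(\mathsf G_x=0\text{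 if }x\notin\phi(X)).$$ For Hilbert spaces $\mathcal H_x$ and (possibly unbounded) operators $\varLambda_x\colon\mathcal H_{\phi(x)}\supseteq\mathrm{dom}(\varLambda_x)\to\mathcal H_x$, $x\in X$, the operator-weighted composition operator $C_{\phi,\boldsymbol\varLambda}$ in $\ell^2(\{\mathcal H_x\})$ is $(C_{\phi,\boldsymbol\varLambda}\boldsymbol f)_x=\varLambda_xf_{\phi(x)}$, with domain the set of all $\boldsymbol f\in\ell^2(\{\mathcal H_x\})$ such that $f_{\phi(x)}\in\mathrm{dom}(\varLambda_x)$ for all $x$ and $\sum_x\|\varLambda_xf_{\phi(x)}\|^2<\infty$. Let $C_{\phi,\boldsymbol\varLambda}$ be this operator for $\mathcal H_x=L^2(\varrho)$ and $\varLambda_x=M_{\lambda_x}$, and let $C_{\phi,\widehat{\boldsymbol\varLambda}}$ be this operator for $\mathcal H_x=L^2(\widehat\varrho_x)$ and $\varLambda_x=M_{\widehat\lambda_x}\colon L^2(\widehat\varrho_{\phi(x)})\supseteq\mathrm{dom}(M_{\widehat\lambda_x})\to L^2(\widehat\varrho_x)$, where multiplication operators have their maximal domains. Suppose that for every $x\in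 X$, $\mathsf G_x<\infty$ a.e. $[\widehat\varrho_x]$ and $\lambda_x\mathsf G_{\phi(x)}=\lambda_x\mathsf G_x$ a.e. $[\widehat\varrho_x]$. Then: 1. $C_{\phi,\widehat{\boldsymbol\varLambda}}$ is quasinormal, that is, it is closed and densely defined, and $U|A|\subseteq|A|U$, where $A=C_{\phi,\widehat{\boldsymbol\varLambda}}$ and $A=U|A|$ is its polar decomposition. 2. $C_{\phi,\widehat{\boldsymbol\varLambda}}$ is an extension of $C_{\phi,\boldsymbol\varLambda}$: the formula $(Q\boldsymbol f)_x(w,s)=f_x(w)$ defines a linear isometry $Q\colon\ell^2(\{L^2(\varrho)\})\to\ell^2(\{L^2(\widehat\varrho_x)\})$, and for every $\boldsymbol f\in\mathrm{dom}(C_{\phi,\boldsymbol\varLambda})$ one has $Q\boldsymbol f\in\mathrm{dom}(C_{\phi,\widehat{\boldsymbol\varLambda}})$ and $C_{\phi,\widehat{\boldsymbol\varLambda}}Q\boldsymbol f=QC_{\phi,\boldsymbol\varLambda}\boldsymbol f$. 3. $C_{\phi,\boldsymbol\varLambda}$ has a normal extension: there are a complex Hilbert space $\mathcal K$, a linear isometry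 $J$ of $\ell^2(\{L^2(\varrho)\})$ into $\mathcal K$ and a normal operator $N$ in $\mathcal K$ (closed, densely defined, $N^*N=NN^*$) with $J\boldsymbol f\in\mathrm{dom}(N)$ and $NJ\boldsymbol f=JC_{\phi,\boldsymbol\varLambda}\boldsymbol f$ for all $\boldsymbol f\in\mathrm{dom}(C_{\phi,\boldsymbol\varLambda})$. In particular, if $C_{\phi,\boldsymbol\varLambda}$ is densely defined, then it is subnormal (that is, densely defined with a normal extension). -/

import Mathlib

open MeasureTheory ProbabilityTheory
open scoped ENNReal

universe u v w

namespace OWCO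

/-! ### Unbounded operators in complex Hilbert spaces -/

section Operators

variable {E F G : Type*}
  [NormedAddCommGroup E] [InnerProductSpace ℂ E]
  [NormedAddCommGroup F] [InnerProductSpace ℂ F]
  [NormedAddCommGroup G] [InnerProductSpace ℂ G]

/-- The product `S T` of two unbounded operators, on its natural domain
`{f ∈ dom T : T f ∈ dom S}`. -/
def pcomp (S : F →ₗ.[ℂ] G) (T : E →ₗ.[ℂ] F) : E →ₗ.[ℂ] G where
  domain :=
    { carrier := {f | ∃ h : f ∈ T.domain, T ⟨f, h⟩ ∈ S.domain}
      zero_mem' := ⟨T.domain.zero_mem, by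
        have : T ⟨0, T.domain.zero_mem⟩ = 0 := T.map_zero
        rw [this]; exact S.domain.zero_mem⟩
      add_mem' := by
        rintro f g ⟨hf, hf'⟩ ⟨hg, hg'⟩
        refine ⟨T.domain.add_mem hf hg, ?_⟩
        have : T ⟨f + g, T.domain.add_mem hf hg⟩ = T ⟨f, hf⟩ + T ⟨g, hg⟩ :=
          T.map_add ⟨f, hf⟩ ⟨g, hg⟩
        rw [this]; exact S.domain.add_mem hf' hg'
      smul_mem' := by
        rintro c f ⟨hf, hf'⟩
        refine ⟨T.domain.smul_mem c hf, ?_⟩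
        have : T ⟨c • f, T.domain.smul_mem c hf⟩ = c • T ⟨f, hf⟩ := T.map_smul c ⟨f, hf⟩
        rw [this]; exact S.domain.smul_mem c hf' }
  toFun :=
    { toFun := fun f => S ⟨T ⟨f.1, f.2.choose⟩, f.2.choose_spec⟩
      map_add' := by
        intro f g
        rw [← S.map_add]
        congr 1
        apply Subtype.ext
        exact T.map_add ⟨f.1, f.2.choose⟩ ⟨g.1, g.2.choose⟩
      map_smul' := by
        intro c f
        rw [RingHom.id_apply, ← S.map_smul]
        congr 1
        apply Subtype.ext
        exact T.map_smul c ⟨f.1, f.2.choose⟩ }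

/-- An everywhere defined bounded operator, seen as a partially defined one. -/
def ofBounded (U : E →L[ℂ] F) : E →ₗ.[ℂ] F := (U : E →ₗ[ℂ] F).toPMap ⊤

/-- `T` extends `S` after the identification of `E` with a subspace of `F` by the isometry `J`:
`J (dom S) ⊆ dom T` and `T J f = J S f` for all `f ∈ dom S`. -/
def ExtendsAlong (J : E →ₗᵢ[ℂ] F) (S : E →ₗ.[ℂ] E) (T : F →ₗ.[ℂ] F) : Prop :=
  ∀ f : S.domain, ∃ h : J (f : E) ∈ T.domain, T ⟨J (f : E), h⟩ = J (S f)

variable [CompleteSpace E]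

/-- A normal operator: closed, densely defined, with `N* N = N N*` (equality of unbounded
operators, domains included). -/
def IsNormalOp (N : E →ₗ.[ℂ] E) : Prop :=
  Dense (N.domain : Set E) ∧ N.IsClosed ∧ pcomp N.adjoint N = pcomp N N.adjoint

/-- `P` is the modulus `|A| = (A* A)^{1/2}` of `A`: the positive selfadjoint operator with
`P² = A* A`. -/
def IsModulus (A P : E →ₗ.[ℂ] E) : Prop :=
  IsSelfAdjoint P ∧ (∀ f : P.domain, 0 ≤ (inner ℂ (P f) (f : E)).re) ∧
    pcomp P P = pcomp A.adjoint A

/-- `A = U P` is the polar decomposition of `A`: `P = |A|` and `U` is a partial isometry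
with the same kernel as `A`. -/
def IsPolarDecomposition (A : E →ₗ.[ℂ] E) (U : E →L[ℂ] E) (P : E →ₗ.[ℂ] E) : Prop :=
  IsModulus A P ∧
    (∀ f : E, f ∈ (LinearMap.ker (U : E →ₗ[ℂ] E))ᗮ → ‖U f‖ = ‖f‖) ∧
    (∀ f : E, U f = 0 ↔ ∃ h : f ∈ A.domain, A ⟨f, h⟩ = 0) ∧
    A = pcomp (ofBounded U) P

/-- A quasinormal operator: closed, densely defined, with `U |A| ⊆ |A| U`, where `A = U |A|` is
the polar decomposition. -/
def IsQuasinormal (A : E →ₗ.[ℂ] E) : Prop :=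
  Dense (A.domain : Set E) ∧ A.IsClosed ∧
    ∃ (U : E →L[ℂ] E) (P : E →ₗ.[ℂ] E), IsPolarDecomposition A U P ∧
      pcomp (ofBounded U) P ≤ pcomp P (ofBounded U)

end Operators

/-- `S` has a normal extension, possibly in a larger Hilbert space (living in `Type k`). -/
def HasNormalExtension.{k, l} {H : Type l} [NormedAddCommGroup H] [InnerProductSpace ℂ H]
    (S : H →ₗ.[ℂ] H) : Prop :=
  ∃ (K : Type k) (_ : NormedAddCommGroup K) (_ : InnerProductSpace ℂ K) (_ : CompleteSpace K)
    (J : H →ₗᵢ[ℂ] K) (N : K →ₗ.[ℂ] K), IsNormalOp N ∧ ExtendsAlong J S N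

/-- A subnormal operator: densely defined, with a normal extension. -/
def IsSubnormal.{k, l} {H : Type l} [NormedAddCommGroup H] [InnerProductSpace ℂ H]
    (S : H →ₗ.[ℂ] H) : Prop :=
  Dense (S.domain : Set H) ∧ HasNormalExtension.{k} S

/-! ### Operator-weighted composition operators -/

section Owco

variable {X : Type*} {H : X → Type*} [∀ x, NormedAddCommGroup (H x)]
  [∀ x, InnerProductSpace ℂ (H x)]

/-- The operator-weighted composition operator `C_{φ,Λ}` in `ℓ²(H)` (counting measure on `X`):
its domain consists of all `f` with `f_{φ(x)} ∈ dom Λ_x` for all `x` and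
`∑ ‖Λ_x f_{φ(x)}‖² < ∞`, and `(C f)_x = Λ_x f_{φ(x)}`. -/
def owco (φ : X → X) (Λ : ∀ x, H (φ x) →ₗ.[ℂ] H x) : lp H 2 →ₗ.[ℂ] lp H 2 where
  domain :=
    { carrier := {f | ∃ h : ∀ x, f (φ x) ∈ (Λ x).domain, Memℓp (fun x => Λ x ⟨f (φ x), h x⟩) 2}
      zero_mem' := by
        refine ⟨fun x => (Λ x).domain.zero_mem, ?_⟩
        have : (fun x => Λ x ⟨(0 : lp H 2) (φ x), (Λ x).domain.zero_mem⟩) = (0 : ∀ x, H x) := by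
          funext x; exact (Λ x).map_zero
        rw [this]; exact zero_memℓp
      add_mem' := by
        rintro f g ⟨hf, hf'⟩ ⟨hg, hg'⟩
        refine ⟨fun x => (Λ x).domain.add_mem (hf x) (hg x), ?_⟩
        have := hf'.add hg'
        refine (congrArg (fun u => Memℓp u 2) ?_).mp this
        funext x
        exact ((Λ x).map_add ⟨_, hf x⟩ ⟨_, hg x⟩).symm
      smul_mem' := by
        rintro c f ⟨hf, hf'⟩
        refine ⟨fun x => (Λ x).domain.smul_mem c (hf x), ?_⟩
        have := hf'.const_smul c
        refine (congrArg (fun u => Memℓp u 2) ?_).mp this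
        funext x
        exact ((Λ x).map_smul c ⟨_, hf x⟩).symm }
  toFun :=
    { toFun := fun f => ⟨fun x => Λ x ⟨f.1 (φ x), f.2.choose x⟩, f.2.choose_spec⟩
      map_add' := by
        intro f g
        apply lp.ext
        funext x
        exact (Λ x).map_add ⟨_, f.2.choose x⟩ ⟨_, g.2.choose x⟩
      map_smul' := by
        intro c f
        apply lp.ext
        funext x
        exact (Λ x).map_smul c ⟨_, f.2.choose x⟩ }

end Owco

/-! ### Multiplication operators between `L²` spaces of two measures -/

section Mul

variable {Ω : Type*} [MeasurableSpace Ω]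

/-- If `|Γ|² ν ≪ μ`, then multiplication by `Γ` respects almost everywhere equality. -/
theorem mul_ae_congr {μ ν : Measure Ω} {Γ : Ω → ℂ} (hΓ : Measurable Γ)
    (h : ν.withDensity (fun p => ‖Γ p‖ₑ ^ 2) ≪ μ) {f g : Ω → ℂ} (hfg : f =ᵐ[μ] g) :
    (fun p => Γ p * f p) =ᵐ[ν] fun p => Γ p * g p := by
  have h1 := h.ae_le hfg
  have h2 : ∀ᵐ p ∂ν, ‖Γ p‖ₑ ^ 2 ≠ 0 → f p = g p :=
    (ae_withDensity_iff (by fun_prop)).1 h1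
  filter_upwards [h2] with p hp
  by_cases h0 : Γ p = 0
  · simp [h0]
  · rw [hp (by simpa using h0)]

/-- The operator `M_Γ : L²(μ) ⊇ dom(M_Γ) → L²(ν)` of multiplication by `Γ`, where
`|Γ|² ν ≪ μ`; its domain is `{f ∈ L²(μ) : Γ f ∈ L²(ν)}`. -/
noncomputable def mulOp (μ ν : Measure Ω) (Γ : Ω → ℂ) (hΓ : Measurable Γ)
    (h : ν.withDensity (fun p => ‖Γ p‖ₑ ^ 2) ≪ μ) : Lp ℂ 2 μ →ₗ.[ℂ] Lp ℂ 2 ν where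
  domain :=
    { carrier := {f | MemLp (fun p => Γ p * f p) 2 ν}
      zero_mem' := by
        have h1 := mul_ae_congr hΓ h (Lp.coeFn_zero ℂ 2 μ)
        refine MemLp.ae_eq h1.symm ?_
        simp
      add_mem' := by
        intro f g hf hg
        have h1 := mul_ae_congr hΓ h (Lp.coeFn_add f g)
        refine MemLp.ae_eq h1.symm ?_
        refine (MemLp.add hf hg).ae_eq (Filter.Eventually.of_forall fun p => ?_)
        simp [mul_add]
      smul_mem' := by
        intro c f hf
        have h1 := mul_ae_congr hΓ h (Lp.coeFn_smul c f)
        refine MemLp.ae_eq h1.symm ?_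
        refine (MemLp.const_smul hf c).ae_eq (Filter.Eventually.of_forall fun p => ?_)
        simp [mul_left_comm] }
  toFun :=
    { toFun := fun f => MemLp.toLp (fun p => Γ p * f.1 p) f.2
      map_add' := by
        intro f g
        rw [← MemLp.toLp_add]
        refine MemLp.toLp_congr _ _ ?_
        refine (mul_ae_congr hΓ h (Lp.coeFn_add f.1 g.1)).trans
          (Filter.Eventually.of_forall fun p => ?_)
        simp [mul_add]
      map_smul' := by
        intro c f
        rw [RingHom.id_apply, ← MemLp.toLp_const_smul]
        refine MemLp.toLp_congr _ _ ?_
        refine (mul_ae_congr hΓ h (Lp.coeFn_smul c f.1)).trans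
          (Filter.Eventually.of_forall fun p => ?_)
        simp [mul_left_comm] }

end Mul

/-! ### The operators built from multiplication weights and a measurable family of measures -/

section Criterion

variable {X W S : Type*} [MeasurableSpace W] [MeasurableSpace S]

/-- `C_{φ,Λ}` in `ℓ²({L²(ρ)})` with `Λ_x = M_{lam x}` acting in `L²(ρ)`. -/
noncomputable def baseOp (φ : X → X) (ρ : Measure W) (lam : X → W → ℂ)
    (hlam : ∀ x, Measurable (lam x)) :
    lp (fun _ : X => Lp ℂ 2 ρ) 2 →ₗ.[ℂ] lp (fun _ : X => Lp ℂ 2 ρ) 2 :=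
  owco (H := fun _ : X => Lp ℂ 2 ρ) φ
    fun x => mulOp ρ ρ (lam x) (hlam x) (withDensity_absolutelyContinuous _ _)

/-- The measure `ρ̂_x` on `W × S`: `ρ̂_x(E) = ∫_W ϑ_x^w {s : (w,s) ∈ E} dρ(w)`. -/
noncomputable abbrev hatMeasure (ρ : Measure W) (ϑ : X → Kernel W S) (x : X) : Measure (W × S) :=
  ρ ⊗ₘ ϑ x

/-- The function `λ̂_x(w,s) = lam x w` on `W × S`. -/
def hatWeight (lam : X → W → ℂ) (x : X) : W × S → ℂ := fun p => lam x p.1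

theorem measurable_hatWeight {lam : X → W → ℂ} (hlam : ∀ x, Measurable (lam x)) (x : X) :
    Measurable (hatWeight lam x : W × S → ℂ) :=
  (hlam x).comp measurable_fst

/-- The measure `|λ̂_x|² ρ̂_x` on `W × S`. -/
noncomputable def weightedMeasure (ρ : Measure W) (lam : X → W → ℂ) (ϑ : X → Kernel W S) (x : X) :
    Measure (W × S) :=
  (hatMeasure ρ ϑ x).withDensity fun p => ‖hatWeight lam x p‖ₑ ^ 2

/-- If `|lam x w|² ϑ_x^w ≪ ϑ_{φ(x)}^w` for all `x`, `w`, then `|λ̂_x|² ρ̂_x ≪ ρ̂_{φ(x)}`;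
so multiplication by `λ̂_x` is well defined from `L²(ρ̂_{φ(x)})` to `L²(ρ̂_x)`. -/
theorem weightedMeasure_absolutelyContinuous (φ : X → X) (ρ : Measure W) [SigmaFinite ρ]
    {lam : X → W → ℂ} (hlam : ∀ x, Measurable (lam x)) (ϑ : X → Kernel W S)
    [∀ x, IsMarkovKernel (ϑ x)] (hB : ∀ x w, (‖lam x w‖ₑ ^ 2) • ϑ x w ≪ ϑ (φ x) w) (x : X) :
    weightedMeasure ρ lam ϑ x ≪ hatMeasure ρ ϑ (φ x) := by
  refine Measure.AbsolutelyContinuous.mk fun A hA h0 => ?_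
  have hm : Measurable fun p : W × S => ‖hatWeight lam x p‖ₑ ^ 2 := by
    have := measurable_hatWeight (S := S) hlam x
    fun_prop
  rw [weightedMeasure, withDensity_apply _ hA, ← lintegral_indicator hA,
    Measure.lintegral_compProd (hm.indicator hA)]
  rw [hatMeasure, Measure.compProd_apply hA, lintegral_eq_zero_iff
    (Kernel.measurable_kernel_prodMk_left hA)] at h0
  rw [lintegral_eq_zero_iff (Measurable.lintegral_kernel_prod_right' (hm.indicator hA))]
  filter_upwards [h0] with w hw
  have h1 : ‖lam x w‖ₑ ^ 2 * ϑ x w (Prod.mk w ⁻¹' A) = 0 := hB x w hw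
  have h2 : (fun s => A.indicator (fun p : W × S => ‖hatWeight lam x p‖ₑ ^ 2) (w, s)) =
      (Prod.mk w ⁻¹' A).indicator fun _ => ‖lam x w‖ₑ ^ 2 := by
    funext s
    by_cases hs : (w, s) ∈ A <;> simp [hs, hatWeight]
  rw [h2, lintegral_indicator_const (measurable_prodMk_left hA)]
  exact h1

/-- `C_{φ,Λ̂}` in `ℓ²({L²(ρ̂_x)})`, where `Λ̂_x = M_{λ̂_x}` acts from `L²(ρ̂_{φ(x)})` to
`L²(ρ̂_x)`. -/
noncomputable def hatOp (φ : X → X) (ρ : Measure W) [SigmaFinite ρ] (lam : X → W → ℂ)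
    (hlam : ∀ x, Measurable (lam x)) (ϑ : X → Kernel W S) [∀ x, IsMarkovKernel (ϑ x)]
    (hB : ∀ x w, (‖lam x w‖ₑ ^ 2) • ϑ x w ≪ ϑ (φ x) w) :
    lp (fun x : X => Lp ℂ 2 (hatMeasure ρ ϑ x)) 2 →ₗ.[ℂ]
      lp (fun x : X => Lp ℂ 2 (hatMeasure ρ ϑ x)) 2 :=
  owco (H := fun x : X => Lp ℂ 2 (hatMeasure ρ ϑ x)) φ
    fun x => mulOp (hatMeasure ρ ϑ (φ x)) (hatMeasure ρ ϑ x) (hatWeight lam x)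
      (measurable_hatWeight hlam x) (weightedMeasure_absolutelyContinuous φ ρ hlam ϑ hB x)

/-- `G_x = ∑_{y ∈ φ⁻¹({x})} d(|λ̂_y|² ρ̂_y) / dρ̂_x`, with values in `[0,∞]`; it is `0` if
`x ∉ φ(X)`. -/
noncomputable def gFun (φ : X → X) (ρ : Measure W) (lam : X → W → ℂ) (ϑ : X → Kernel W S) (x : X) :
    W × S → ℝ≥0∞ :=
  fun p => ∑' y : φ ⁻¹' {x}, (weightedMeasure ρ lam ϑ y).rnDeriv (hatMeasure ρ ϑ x) p

end Criterion

end OWCO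

/-!
Throughout, an unbounded operator is handled through its graph, so that identities between products
of operators become statements about pairs of vectors.

*Quasinormality.* Summing `∫ |λ̂_x|² |f_{φ(x)}|² dρ̂_x` over the fibres of `φ` and changing variables
by Radon-Nikodym (`tsum_lintegral_mul_weight`) gives `∑ ‖λ̂_x f_{φ(x)}‖² = ∑ ‖√G_x f_x‖²`. So the
modulus of `A = C_{φ,Λ̂}` has to be the operator `P` of multiplication by `√G_x` in the coordinate
`x`, and the partial isometry `U` has to be `(U f)_x = λ̂_x / √G_{φ(x)} · f_{φ(x)}`, which is
contractive by the same change of variables. The hypothesis `λ_x G_{φ(x)} = λ_x G_x` says exactly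
that `√G_x` and `√G_{φ(x)}` agree where `λ_x ≠ 0`, that is, `U P ⊆ P U`. The operator `P` is
selfadjoint because it is symmetric, positive and `P + 1` is onto
(`isSelfAdjoint_of_surjective_add_one`). Then `A* = P U*` and `U* U P = P` give `A* A = P²`, and
closedness and density of the domain are inherited from `P` (`isQuasinormal_ofBounded_pcomp`).

*Normal extension.* If `A = U P` is quasinormal, both `U` and `U*` commute with `P`, and
`V = [[U, 1 - U U*], [1 - U* U, U*]]` is a unitary operator on the sum of two copies of the space
commuting with `P ⊕ P`. Hence `V (P ⊕ P)` is normal, and it extends `A` since `(1 - U* U) P = 0`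
(`IsQuasinormal.exists_normal_extension`).

*The embedding.* As the `ϑ_x^w` are probability measures, the first marginal of `ρ̂_x` is `ρ`, so
`f ↦ f ∘ fst` is isometric from `L²(ρ)` to `L²(ρ̂_x)`; it intertwines the two operators, whence the
normal extension of `C_{φ,Λ̂}` is one of `C_{φ,Λ}`.
-/

namespace OWCO

/-! ### Graphs of unbounded operators -/

section Graph

variable {E F G : Type*}
  [NormedAddCommGroup E] [InnerProductSpace ℂ E]
  [NormedAddCommGroup F] [InnerProductSpace ℂ F]
  [NormedAddCommGroup G] [InnerProductSpace ℂ G]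

theorem mem_graph_iff_exists {T : E →ₗ.[ℂ] F} {f : E} {g : F} :
    (f, g) ∈ T.graph ↔ ∃ h : f ∈ T.domain, T ⟨f, h⟩ = g := by
  simp [LinearPMap.mem_graph_iff]

theorem mem_graph_pcomp {S : F →ₗ.[ℂ] G} {T : E →ₗ.[ℂ] F} {f : E} {g : G} :
    (f, g) ∈ (pcomp S T).graph ↔ ∃ k, (f, k) ∈ T.graph ∧ (k, g) ∈ S.graph := by
  simp only [mem_graph_iff_exists]
  constructor
  · rintro ⟨h, rfl⟩
    exact ⟨_, ⟨h.choose, rfl⟩, h.choose_spec, rfl⟩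
  · rintro ⟨k, ⟨h, rfl⟩, h', rfl⟩
    exact ⟨⟨h, h'⟩, rfl⟩

theorem mem_graph_ofBounded {U : E →L[ℂ] F} {f : E} {g : F} :
    (f, g) ∈ (ofBounded U).graph ↔ U f = g := by
  rw [mem_graph_iff_exists]
  exact ⟨fun ⟨_, h⟩ => h, fun h => ⟨Submodule.mem_top, h⟩⟩

theorem mem_graph_ofBounded_pcomp {U : F →L[ℂ] G} {T : E →ₗ.[ℂ] F} {f : E} {g : G} :
    (f, g) ∈ (pcomp (ofBounded U) T).graph ↔ ∃ k, (f, k) ∈ T.graph ∧ U k = g := by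
  simp only [mem_graph_pcomp, mem_graph_ofBounded]

theorem mem_graph_pcomp_ofBounded {S : F →ₗ.[ℂ] G} {U : E →L[ℂ] F} {f : E} {g : G} :
    (f, g) ∈ (pcomp S (ofBounded U)).graph ↔ (U f, g) ∈ S.graph := by
  simp only [mem_graph_pcomp, mem_graph_ofBounded, exists_eq_left']

theorem ext_graph {S T : E →ₗ.[ℂ] F} (h : ∀ f g, (f, g) ∈ S.graph ↔ (f, g) ∈ T.graph) : S = T :=
  LinearPMap.eq_of_eq_graph (Submodule.ext fun p => h p.1 p.2)

theorem pcomp_ofBounded_domain (U : F →L[ℂ] G) (T : E →ₗ.[ℂ] F) :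
    (pcomp (ofBounded U) T).domain = T.domain := by
  ext f
  exact ⟨fun h => h.choose, fun h => ⟨h, Submodule.mem_top⟩⟩

/-- If a bounded operator `V` satisfies `V U T = T`, then the graph of `U T` is the closed set
`{(f, g) : (f, V g) ∈ graph T, U V g = g}`. -/
theorem isClosed_ofBounded_pcomp {U : F →L[ℂ] G} {V : G →L[ℂ] F} {T : E →ₗ.[ℂ] F}
    (hT : T.IsClosed) (hV : ∀ f k, (f, k) ∈ T.graph → V (U k) = k) :
    (pcomp (ofBounded U) T).IsClosed := by
  have hset : ((pcomp (ofBounded U) T).graph : Set (E × G)) =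
      (fun p : E × G => (p.1, V p.2)) ⁻¹' (T.graph : Set (E × F)) ∩ {p | U (V p.2) = p.2} := by
    ext ⟨f, g⟩
    simp only [SetLike.mem_coe, mem_graph_ofBounded_pcomp, Set.mem_inter_iff, Set.mem_preimage]
    constructor
    · rintro ⟨k, hk, rfl⟩
      have := hV f k hk
      exact ⟨by rwa [this], by change U (V (U k)) = U k; rw [this]⟩
    · rintro ⟨h1, h2⟩
      exact ⟨V g, h1, h2⟩
  rw [LinearPMap.IsClosed, hset]
  exact (hT.preimage (by fun_prop)).inter (isClosed_eq (by fun_prop) (by fun_prop))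

variable [CompleteSpace E]

theorem mem_graph_adjoint {T : E →ₗ.[ℂ] F} (hT : Dense (T.domain : Set E)) {y : F} {z : E} :
    (y, z) ∈ T.adjoint.graph ↔ ∀ f g, (f, g) ∈ T.graph → inner ℂ z f = inner ℂ y g := by
  rw [LinearPMap.adjoint_graph_eq_graph_adjoint hT, Submodule.mem_adjoint_iff]
  refine forall_congr' fun f => forall_congr' fun g => imp_congr_right fun _ => ?_
  rw [sub_eq_zero, ← inner_conj_symm g, ← inner_conj_symm f, RingHom.injective _ |>.eq_iff, eq_comm]

theorem mem_graph_iff_of_isSelfAdjoint {P : E →ₗ.[ℂ] E} (hP : IsSelfAdjoint P) {y z : E} :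
    (y, z) ∈ P.graph ↔ ∀ f g, (f, g) ∈ P.graph → inner ℂ z f = inner ℂ y g := by
  conv_lhs => rw [← LinearPMap.isSelfAdjoint_def.1 hP]
  exact mem_graph_adjoint hP.dense_domain

/-- `(U T)* = T* U*` for bounded `U`. -/
theorem adjoint_ofBounded_pcomp [CompleteSpace F] [CompleteSpace G] {U : F →L[ℂ] G}
    {T : E →ₗ.[ℂ] F} (hT : Dense (T.domain : Set E)) :
    (pcomp (ofBounded U) T).adjoint = pcomp T.adjoint (ofBounded U.adjoint) := by
  refine ext_graph fun y z => ?_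
  rw [mem_graph_adjoint (by rwa [pcomp_ofBounded_domain]), mem_graph_pcomp_ofBounded,
    mem_graph_adjoint hT]
  simp only [mem_graph_ofBounded_pcomp, ContinuousLinearMap.adjoint_inner_left]
  exact ⟨fun h f k hk => h f _ ⟨k, hk, rfl⟩, fun h f g ⟨k, hk, hg⟩ => hg ▸ h f k hk⟩

/-- The range of `P + 1` being everything makes up for the missing inclusion `P* ⊆ P`; positivity
gives that the domain is dense. -/
theorem isSelfAdjoint_of_surjective_add_one {P : E →ₗ.[ℂ] E} (hsymm : P.IsFormalAdjoint P)
    (hpos : ∀ f : P.domain, 0 ≤ (inner ℂ (P f) (f : E)).re)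
    (hsurj : ∀ g, ∃ f : P.domain, P f + f = g) : IsSelfAdjoint P := by
  have hd : Dense (P.domain : Set E) := by
    refine (Submodule.dense_iff_topologicalClosure_eq_top).2
      ((Submodule.topologicalClosure_eq_top_iff).2 ((Submodule.eq_bot_iff _).2 fun g hg => ?_))
    obtain ⟨f, rfl⟩ := hsurj g
    have h0 : inner ℂ (P f + f) (f : E) = 0 := (Submodule.mem_orthogonal' _ _).1 hg f f.2
    have h1 := congrArg Complex.re h0
    rw [inner_add_left, Complex.add_re, Complex.zero_re] at h1
    have h2 := hpos f
    have h3 : (inner ℂ (f : E) (f : E)).re = ‖(f : E)‖ ^ 2 := inner_self_eq_norm_sq (𝕜 := ℂ) _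
    have h4 : (f : E) = 0 := by
      rw [← norm_eq_zero, ← sq_eq_zero_iff]
      nlinarith [sq_nonneg ‖(f : E)‖]
    have h5 : f = 0 := Subtype.ext h4
    simp [h5]
  refine LinearPMap.isSelfAdjoint_def.2 (ext_graph fun y z => ?_)
  constructor
  · intro h
    rw [mem_graph_adjoint hd] at h
    obtain ⟨f, hf⟩ := hsurj (z + y)
    have key : y - f = 0 := by
      obtain ⟨k, hk⟩ := hsurj (y - f)
      have h1 := h k (P k) (P.mem_graph k)
      have h2 := hsymm f k
      have h3 : inner ℂ (y - f) (P k + k) = 0 := by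
        have h4 : inner ℂ (z + y) (k : E) = inner ℂ (P f + f) (k : E) := by rw [hf]
        simp only [inner_add_left, inner_add_right, inner_sub_left] at h4 ⊢
        rw [← h1, ← h2]
        linear_combination h4
      rw [hk] at h3
      exact inner_self_eq_zero.1 h3
    obtain rfl := sub_eq_zero.1 key
    rw [add_left_inj] at hf
    exact hf ▸ P.mem_graph f
  · intro h
    exact LinearPMap.le_graph_of_le (hsymm.le_adjoint hd) h

end Graph

/-! ### Quasinormal operators -/

section Quasinormal

variable {E : Type*} [NormedAddCommGroup E] [InnerProductSpace ℂ E] [CompleteSpace E]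

/-- A bounded operator that is isometric on the complement of its kernel satisfies
`U* U f = f` there. -/
theorem adjoint_apply_apply_of_mem_ker_orthogonal {U : E →L[ℂ] E}
    (hU : ∀ f : E, f ∈ (LinearMap.ker (U : E →ₗ[ℂ] E))ᗮ → ‖U f‖ = ‖f‖) {f : E}
    (hf : f ∈ (LinearMap.ker (U : E →ₗ[ℂ] E))ᗮ) : U.adjoint (U f) = f := by
  set M := LinearMap.ker (U : E →ₗ[ℂ] E) with hM
  have : CompleteSpace M := (ContinuousLinearMap.isClosed_ker U).completeSpace_coe
  have hUM : ∀ x ∈ M, U x = 0 := fun x hx => hx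
  -- polarization: on `Mᗮ`, `U` preserves inner products
  let V : Mᗮ →ₗᵢ[ℂ] E := ⟨(U : E →ₗ[ℂ] E).comp Mᗮ.subtype, fun x => hU x x.2⟩
  refine ext_inner_right ℂ fun h => ?_
  rw [ContinuousLinearMap.adjoint_inner_left]
  obtain ⟨a, ha, b, hb, rfl⟩ := M.exists_add_mem_mem_orthogonal h
  rw [map_add, hUM a ha, zero_add, inner_add_right, (Submodule.mem_orthogonal' _ _).1 hf a ha,
    zero_add]
  exact V.inner_map_map ⟨f, hf⟩ ⟨b, hb⟩

theorem apply_adjoint_apply_apply {U : E →L[ℂ] E}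
    (hU : ∀ f : E, f ∈ (LinearMap.ker (U : E →ₗ[ℂ] E))ᗮ → ‖U f‖ = ‖f‖) (f : E) :
    U (U.adjoint (U f)) = U f := by
  have : CompleteSpace (LinearMap.ker (U : E →ₗ[ℂ] E)) :=
    (ContinuousLinearMap.isClosed_ker U).completeSpace_coe
  obtain ⟨a, ha, b, hb, rfl⟩ := (LinearMap.ker (U : E →ₗ[ℂ] E)).exists_add_mem_mem_orthogonal f
  have : U a = 0 := ha
  rw [map_add, this, zero_add, adjoint_apply_apply_of_mem_ker_orthogonal hU hb]

/-- For selfadjoint `P`, a bounded operator which is isometric on the range of `P` and has the same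
kernel as `P` is isometric on the complement of its kernel, because the range of `P` is dense
there. -/
theorem norm_map_of_mem_ker_orthogonal {U : E →L[ℂ] E} {P : E →ₗ.[ℂ] E} (hP : IsSelfAdjoint P)
    (hiso : ∀ f k, (f, k) ∈ P.graph → ‖U k‖ = ‖k‖) (hker : ∀ f, (f, 0) ∈ P.graph → U f = 0)
    {f : E} (hf : f ∈ (LinearMap.ker (U : E →ₗ[ℂ] E))ᗮ) : ‖U f‖ = ‖f‖ := by
  let R : Submodule ℂ E := P.graph.map (LinearMap.snd ℂ E E)
  have hR : ∀ k ∈ R, ∃ g, (g, k) ∈ P.graph := by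
    rintro k ⟨⟨a, b⟩, h, rfl⟩
    exact ⟨a, h⟩
  have h1 : Rᗮ ≤ LinearMap.ker (U : E →ₗ[ℂ] E) := fun g hg =>
    hker g ((mem_graph_iff_of_isSelfAdjoint hP).2 fun a b hab => by
      rw [inner_zero_left, (Submodule.mem_orthogonal' _ _).1 hg b ⟨(a, b), hab, rfl⟩])
  have h2 : f ∈ R.topologicalClosure := by
    rw [← Submodule.orthogonal_orthogonal_eq_closure]
    exact Submodule.orthogonal_le h1 hf
  have h3 : IsClosed {g : E | ‖U g‖ = ‖g‖} := isClosed_eq (by fun_prop) (by fun_prop)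
  refine closure_minimal ?_ h3 h2
  intro k hk
  obtain ⟨g, hg⟩ := hR k hk
  exact hiso g k hg

/-- A product `U P` is quasinormal, with polar decomposition `U P`, as soon as `P` is positive and
selfadjoint and the bounded operator `U` is isometric on the range of `P`, has the same kernel as
`U P`, and maps the graph of `P` into itself. -/
theorem isQuasinormal_ofBounded_pcomp {U : E →L[ℂ] E} {P : E →ₗ.[ℂ] E} (hP : IsSelfAdjoint P)
    (hpos : ∀ f : P.domain, 0 ≤ (inner ℂ (P f) (f : E)).re)
    (hiso : ∀ f k, (f, k) ∈ P.graph → ‖U k‖ = ‖k‖)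
    (hker : ∀ f, U f = 0 → (f, 0) ∈ (pcomp (ofBounded U) P).graph)
    (hker' : ∀ f, (f, 0) ∈ P.graph → U f = 0)
    (hcomm : ∀ f k, (f, k) ∈ P.graph → (U f, U k) ∈ P.graph) :
    IsQuasinormal (pcomp (ofBounded U) P) := by
  have hd := hP.dense_domain
  have hUP : ∀ f k, (f, k) ∈ P.graph → U k = 0 → k = 0 := fun f k h h0 => by
    rw [← norm_eq_zero, ← hiso f k h, h0, norm_zero]
  have hU : ∀ f : E, f ∈ (LinearMap.ker (U : E →ₗ[ℂ] E))ᗮ → ‖U f‖ = ‖f‖ := fun f hf =>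
    norm_map_of_mem_ker_orthogonal hP hiso hker' hf
  have hkerP : ∀ f, U f = 0 → (f, 0) ∈ P.graph := fun f hf => by
    obtain ⟨k, hk, hk0⟩ := mem_graph_ofBounded_pcomp.1 (hker f hf)
    obtain rfl := hUP f k hk hk0
    exact hk
  have hran : ∀ f k, (f, k) ∈ P.graph → U.adjoint (U k) = k := fun f k hk => by
    refine adjoint_apply_apply_of_mem_ker_orthogonal hU
      ((Submodule.mem_orthogonal' _ _).2 fun g hg => ?_)
    rw [(mem_graph_iff_of_isSelfAdjoint hP).1 hk g 0 (hkerP g hg), inner_zero_right]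
  refine ⟨by rwa [pcomp_ofBounded_domain], isClosed_ofBounded_pcomp hP.isClosed hran, U, P,
    ⟨⟨hP, hpos, ?_⟩, hU, fun f => ⟨fun h => mem_graph_iff_exists.1 (hker f h), fun h => ?_⟩, rfl⟩,
    ?_⟩
  · rw [adjoint_ofBounded_pcomp hd, LinearPMap.isSelfAdjoint_def.1 hP]
    refine ext_graph fun f g => ?_
    simp only [mem_graph_pcomp, mem_graph_ofBounded]
    constructor
    · rintro ⟨k, hk, hg⟩
      exact ⟨U k, ⟨k, hk, rfl⟩, k, hran f k hk, hg⟩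
    · rintro ⟨_, ⟨k, hk, rfl⟩, l, hl, hg⟩
      rw [hran f k hk] at hl
      exact ⟨k, hk, hl ▸ hg⟩
  · obtain ⟨k, hk, hk0⟩ := mem_graph_ofBounded_pcomp.1 (mem_graph_iff_exists.2 h)
    obtain rfl := hUP f k hk hk0
    exact hker' f hk
  · refine LinearPMap.le_of_le_graph fun ⟨f, g⟩ h => ?_
    obtain ⟨k, hk, rfl⟩ := mem_graph_ofBounded_pcomp.1 h
    exact mem_graph_pcomp_ofBounded.2 (hcomm f k hk)

end Quasinormal

/-! ### Normal extensions of quasinormal operators -/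

section NormalExtension

variable {E : Type*} [NormedAddCommGroup E] [InnerProductSpace ℂ E]

/-- The operator `P ⊕ P` in `E ⊕ E`, with domain `dom P ⊕ dom P`. -/
def dsum (P : E →ₗ.[ℂ] E) : WithLp 2 (E × E) →ₗ.[ℂ] WithLp 2 (E × E) where
  domain := (P.domain.prod P.domain).comap (WithLp.linearEquiv 2 ℂ (E × E)).toLinearMap
  toFun :=
    { toFun := fun f => WithLp.toLp 2 (P ⟨f.1.fst, f.2.1⟩, P ⟨f.1.snd, f.2.2⟩)
      map_add' := fun f g => congrArg (WithLp.toLp 2) <| Prod.ext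
        (P.map_add ⟨f.1.fst, f.2.1⟩ ⟨g.1.fst, g.2.1⟩) (P.map_add ⟨f.1.snd, f.2.2⟩ ⟨g.1.snd, g.2.2⟩)
      map_smul' := fun c f => congrArg (WithLp.toLp 2) <| Prod.ext
        (P.map_smul c ⟨f.1.fst, f.2.1⟩) (P.map_smul c ⟨f.1.snd, f.2.2⟩) }

theorem mem_graph_dsum {P : E →ₗ.[ℂ] E} {f g : WithLp 2 (E × E)} :
    (f, g) ∈ (dsum P).graph ↔ (f.fst, g.fst) ∈ P.graph ∧ (f.snd, g.snd) ∈ P.graph := by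
  simp only [mem_graph_iff_exists]
  constructor
  · rintro ⟨h, rfl⟩
    exact ⟨⟨h.1, rfl⟩, ⟨h.2, rfl⟩⟩
  · rintro ⟨⟨h1, e1⟩, ⟨h2, e2⟩⟩
    exact ⟨⟨h1, h2⟩, congrArg (WithLp.toLp 2) (Prod.ext e1 e2)⟩

/-- The operator on `E ⊕ E` with matrix `[[a, b], [c, d]]`. -/
noncomputable def blockOp (a b c d : E →L[ℂ] E) : WithLp 2 (E × E) →L[ℂ] WithLp 2 (E × E) :=
  (WithLp.prodContinuousLinearEquiv 2 ℂ E E).symm.toContinuousLinearMap ∘L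
    ((a.coprod b).prod (c.coprod d)) ∘L
      (WithLp.prodContinuousLinearEquiv 2 ℂ E E).toContinuousLinearMap

theorem blockOp_apply (a b c d : E →L[ℂ] E) (f : WithLp 2 (E × E)) :
    blockOp a b c d f = WithLp.toLp 2 (a f.fst + b f.snd, c f.fst + d f.snd) := rfl

variable [CompleteSpace E]

/-- If `P` is selfadjoint and the unitary operator `V` commutes with `P`, then `V P` is normal. -/
theorem isNormalOp_ofBounded_pcomp {V : E →L[ℂ] E} {P : E →ₗ.[ℂ] E} (hP : IsSelfAdjoint P)
    (h1 : ∀ f, V.adjoint (V f) = f) (h2 : ∀ f, V (V.adjoint f) = f)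
    (hc : ∀ f k, (f, k) ∈ P.graph → (V f, V k) ∈ P.graph)
    (hc' : ∀ f k, (f, k) ∈ P.graph → (V.adjoint f, V.adjoint k) ∈ P.graph) :
    IsNormalOp (pcomp (ofBounded V) P) := by
  have hd := hP.dense_domain
  refine ⟨by rwa [pcomp_ofBounded_domain],
    isClosed_ofBounded_pcomp (V := V.adjoint) hP.isClosed fun f k _ => h1 k, ?_⟩
  rw [adjoint_ofBounded_pcomp hd, LinearPMap.isSelfAdjoint_def.1 hP]
  -- both products have the graph of `P²`
  refine ext_graph fun f g => ?_
  simp only [mem_graph_pcomp, mem_graph_ofBounded]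
  constructor
  · rintro ⟨_, ⟨k, hk, rfl⟩, _, rfl, hg⟩
    rw [h1] at hg
    exact ⟨V.adjoint k, ⟨_, rfl, hc' f k hk⟩, V.adjoint g, hc' k g hg, h2 g⟩
  · rintro ⟨k, ⟨_, rfl, hk⟩, l, hl, rfl⟩
    have hk' := hc _ _ hk
    rw [h2] at hk'
    exact ⟨V (V k), ⟨V k, hk', rfl⟩, V k, h1 _, hc k l hl⟩

theorem isSelfAdjoint_dsum {P : E →ₗ.[ℂ] E} (hP : IsSelfAdjoint P) : IsSelfAdjoint (dsum P) := by
  have hd : Dense ((dsum P).domain : Set (WithLp 2 (E × E))) :=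
    (hP.dense_domain.prod hP.dense_domain).preimage
      (WithLp.prodContinuousLinearEquiv 2 ℂ E E).toHomeomorph.isOpenMap
  refine LinearPMap.isSelfAdjoint_def.2 (ext_graph fun y z => ?_)
  rw [mem_graph_adjoint hd, mem_graph_dsum, mem_graph_iff_of_isSelfAdjoint hP,
    mem_graph_iff_of_isSelfAdjoint hP]
  constructor
  · intro h
    refine ⟨fun f g hfg => ?_, fun f g hfg => ?_⟩
    · simpa [WithLp.prod_inner_apply] using h (WithLp.toLp 2 (f, 0)) (WithLp.toLp 2 (g, 0))
        (mem_graph_dsum.2 ⟨hfg, P.graph.zero_mem⟩)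
    · simpa [WithLp.prod_inner_apply] using h (WithLp.toLp 2 (0, f)) (WithLp.toLp 2 (0, g))
        (mem_graph_dsum.2 ⟨P.graph.zero_mem, hfg⟩)
  · rintro ⟨h1, h2⟩ f g hfg
    obtain ⟨hf, hg⟩ := mem_graph_dsum.1 hfg
    rw [WithLp.prod_inner_apply, WithLp.prod_inner_apply]
    exact congrArg₂ (· + ·) (h1 _ _ hf) (h2 _ _ hg)

theorem adjoint_blockOp (a b c d : E →L[ℂ] E) :
    (blockOp a b c d).adjoint = blockOp a.adjoint c.adjoint b.adjoint d.adjoint := by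
  symm
  rw [ContinuousLinearMap.eq_adjoint_iff]
  intro f g
  simp only [blockOp_apply, WithLp.prod_inner_apply, inner_add_left, inner_add_right,
    ContinuousLinearMap.adjoint_inner_left, WithLp.ofLp_fst, WithLp.ofLp_snd]
  ring

/-- Let `A = U P` be the polar decomposition of a quasinormal operator. Then `U` and `U*` commute
with `P`, and `[[U, 1 - U U*], [1 - U* U, U*]]` is a unitary operator on `E ⊕ E` which commutes
with `P ⊕ P`. Their product is normal, and it extends `A` since `U* U P = P`. -/
theorem IsQuasinormal.exists_normal_extension {A : E →ₗ.[ℂ] E} (hA : IsQuasinormal A) :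
    ∃ (J : E →ₗᵢ[ℂ] WithLp 2 (E × E)) (N : WithLp 2 (E × E) →ₗ.[ℂ] WithLp 2 (E × E)),
      IsNormalOp N ∧ ExtendsAlong J A N := by
  obtain ⟨-, -, U, P, ⟨⟨hP, -, hPP⟩, hU, hker, hAU⟩, hcomm⟩ := hA
  have hsym : ∀ {f g h k : E}, (f, g) ∈ P.graph → (h, k) ∈ P.graph → inner ℂ g h = inner ℂ f k :=
    fun h1 h2 => (mem_graph_iff_of_isSelfAdjoint hP).1 h1 _ _ h2
  have hc : ∀ f k, (f, k) ∈ P.graph → (U f, U k) ∈ P.graph := fun f k hk =>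
    mem_graph_pcomp_ofBounded.1 (LinearPMap.le_graph_of_le hcomm
      (mem_graph_ofBounded_pcomp.2 ⟨k, hk, rfl⟩))
  have hc' : ∀ f k, (f, k) ∈ P.graph → (U.adjoint f, U.adjoint k) ∈ P.graph := fun f k hk => by
    refine (mem_graph_iff_of_isSelfAdjoint hP).2 fun g l hl => ?_
    rw [ContinuousLinearMap.adjoint_inner_left, ContinuousLinearMap.adjoint_inner_left]
    exact hsym hk (hc g l hl)
  -- if `U h = 0` then `A h = 0`, so `P² h = A* A h = 0` and `‖P h‖² = ⟪P² h, h⟫ = 0`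
  have hkerP : ∀ h, U h = 0 → (h, 0) ∈ P.graph := fun h hh => by
    have h1 : (h, 0) ∈ (pcomp P P).graph := by
      rw [hPP]
      exact mem_graph_pcomp.2 ⟨0, mem_graph_iff_exists.2 ((hker h).1 hh),
        A.adjoint.graph.zero_mem⟩
    obtain ⟨k, hk, hk0⟩ := mem_graph_pcomp.1 h1
    have h2 : inner ℂ k k = 0 := by rw [← hsym hk0 hk, inner_zero_left]
    obtain rfl := inner_self_eq_zero.1 h2
    exact hk
  have hran : ∀ f k, (f, k) ∈ P.graph → U.adjoint (U k) = k := fun f k hk => by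
    refine adjoint_apply_apply_of_mem_ker_orthogonal hU
      ((Submodule.mem_orthogonal' _ _).2 fun g hg => ?_)
    rw [hsym hk (hkerP g hg), inner_zero_right]
  have e1 : ∀ f, U (U.adjoint (U f)) = U f := apply_adjoint_apply_apply hU
  have e2 : ∀ f, U.adjoint (U (U.adjoint f)) = U.adjoint f := fun f => by
    refine ext_inner_right ℂ fun g => ?_
    rw [ContinuousLinearMap.adjoint_inner_left, ← ContinuousLinearMap.adjoint_inner_right,
      ContinuousLinearMap.adjoint_inner_left, e1, ContinuousLinearMap.adjoint_inner_left]
  set V := blockOp U (1 - U * U.adjoint) (1 - U.adjoint * U) U.adjoint with hV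
  have hV' : V.adjoint = blockOp U.adjoint (1 - U.adjoint * U) (1 - U * U.adjoint) U := by
    rw [hV, adjoint_blockOp]
    simp only [← ContinuousLinearMap.star_eq_adjoint, star_sub, star_one, star_mul, star_star]
  let J : E →ₗᵢ[ℂ] WithLp 2 (E × E) :=
    { toFun := fun f => WithLp.toLp 2 (f, 0)
      map_add' := fun f g => by rw [← WithLp.toLp_add, Prod.mk_add_mk, add_zero]
      map_smul' := fun c f => by rw [RingHom.id_apply, ← WithLp.toLp_smul, Prod.smul_mk, smul_zero]
      norm_map' := fun f => by simp }
  refine ⟨J, pcomp (ofBounded V) (dsum P), isNormalOp_ofBounded_pcomp (isSelfAdjoint_dsum hP)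
    ?_ ?_ ?_ ?_, ?_⟩
  · intro f
    rw [hV', hV, blockOp_apply, blockOp_apply]
    refine (WithLp.equiv 2 _).injective (Prod.ext ?_ ?_) <;>
      simp [e1, e2]
  · intro f
    rw [hV', hV, blockOp_apply, blockOp_apply]
    refine (WithLp.equiv 2 _).injective (Prod.ext ?_ ?_) <;>
      simp [e1, e2]
  · intro f k hk
    obtain ⟨h1, h2⟩ := mem_graph_dsum.1 hk
    exact mem_graph_dsum.2
      ⟨P.graph.add_mem (hc _ _ h1) (P.graph.sub_mem h2 (hc _ _ (hc' _ _ h2))),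
        P.graph.add_mem (P.graph.sub_mem h1 (hc' _ _ (hc _ _ h1))) (hc' _ _ h2)⟩
  · intro f k hk
    obtain ⟨h1, h2⟩ := mem_graph_dsum.1 hk
    rw [hV']
    exact mem_graph_dsum.2
      ⟨P.graph.add_mem (hc' _ _ h1) (P.graph.sub_mem h2 (hc' _ _ (hc _ _ h2))),
        P.graph.add_mem (P.graph.sub_mem h1 (hc _ _ (hc' _ _ h1))) (hc _ _ h2)⟩
  · intro f
    have hf := LinearPMap.le_graph_of_le hAU.le (A.mem_graph f)
    obtain ⟨k, hk, hkf⟩ := mem_graph_ofBounded_pcomp.1 hf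
    refine mem_graph_iff_exists.1 (mem_graph_ofBounded_pcomp.2
      ⟨WithLp.toLp 2 (k, 0), mem_graph_dsum.2 ⟨hk, P.graph.zero_mem⟩, ?_⟩)
    rw [hV, blockOp_apply]
    refine congrArg (WithLp.toLp 2) (Prod.ext ?_ ?_)
    · simp [hkf]
    · simp [hran _ _ hk]

end NormalExtension

/-! ### Square summable families of square integrable functions -/

section SquareSummable

variable {X Ω : Type*} [MeasurableSpace Ω]

theorem memℓp_two_iff {H : X → Type*} [∀ x, NormedAddCommGroup (H x)] {u : ∀ x, H x} :
    Memℓp u 2 ↔ ∑' x, ‖u x‖ₑ ^ 2 ≠ ∞ := by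
  rw [memℓp_gen_iff (by simp)]
  have h1 : ∀ x, ‖u x‖ₑ ^ 2 = ((‖u x‖₊ ^ 2 : NNReal) : ℝ≥0∞) := fun x => by
    rw [ENNReal.coe_pow]; rfl
  simp_rw [h1]
  rw [ENNReal.tsum_coe_ne_top_iff_summable_coe]
  simp

theorem enorm_lp_sq {H : X → Type*} [∀ x, NormedAddCommGroup (H x)] (f : lp H 2) :
    ‖f‖ₑ ^ 2 = ∑' x, ‖f x‖ₑ ^ 2 := by
  have h := lp.norm_rpow_eq_tsum (p := 2) (by simp) f
  have hs := (memℓp_gen_iff (p := 2) (by simp)).1 (lp.memℓp f)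
  simp only [ENNReal.toReal_ofNat, Real.rpow_ofNat] at h hs
  simp_rw [← ofReal_norm, ← ENNReal.ofReal_pow (norm_nonneg _)]
  rw [h, ENNReal.ofReal_tsum_of_nonneg (fun _ => by positivity) hs]

theorem eLpNorm_two_sq {ν : Measure Ω} (F : Ω → ℂ) :
    eLpNorm F 2 ν ^ 2 = ∫⁻ p, ‖F p‖ₑ ^ 2 ∂ν := by
  simpa using eLpNorm_nnreal_pow_eq_lintegral (f := F) (μ := ν) (p := 2) (by simp)

theorem enorm_Lp_sq {ν : Measure Ω} (f : Lp ℂ 2 ν) : ‖f‖ₑ ^ 2 = ∫⁻ p, ‖f p‖ₑ ^ 2 ∂ν := by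
  rw [Lp.enorm_def, eLpNorm_two_sq]

variable {μ : X → Measure Ω}

theorem enorm_sq_eq_tsum_lintegral (f : lp (fun x => Lp ℂ 2 (μ x)) 2) :
    ‖f‖ₑ ^ 2 = ∑' x, ∫⁻ p, ‖f x p‖ₑ ^ 2 ∂(μ x) := by
  simp_rw [enorm_lp_sq, enorm_Lp_sq]

theorem enorm_sq_eq_of_ae {g : lp (fun x => Lp ℂ 2 (μ x)) 2} {F : X → Ω → ℂ}
    (h : ∀ x, g x =ᵐ[μ x] F x) : ‖g‖ₑ ^ 2 = ∑' x, ∫⁻ p, ‖F x p‖ₑ ^ 2 ∂(μ x) := by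
  rw [enorm_sq_eq_tsum_lintegral]
  exact tsum_congr fun x => lintegral_congr_ae ((h x).mono fun p hp => by simp only [hp])

theorem exists_lp_ae_eq {F : X → Ω → ℂ} (hF : ∀ x, AEStronglyMeasurable (F x) (μ x))
    (h : ∑' x, ∫⁻ p, ‖F x p‖ₑ ^ 2 ∂(μ x) ≠ ∞) :
    ∃ g : lp (fun x => Lp ℂ 2 (μ x)) 2, ∀ x, g x =ᵐ[μ x] F x := by
  have h1 : ∀ x, MemLp (F x) 2 (μ x) := fun x => by
    refine ⟨hF x, ?_⟩
    have := ENNReal.ne_top_of_tsum_ne_top h x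
    rw [← eLpNorm_two_sq] at this
    exact lt_top_iff_ne_top.2 fun h0 => this (by rw [h0]; rfl)
  refine ⟨⟨fun x => (h1 x).toLp (F x), memℓp_two_iff.2 ?_⟩, fun x => (h1 x).coeFn_toLp⟩
  have h2 : ∀ x, ‖(h1 x).toLp (F x)‖ₑ ^ 2 = ∫⁻ p, ‖F x p‖ₑ ^ 2 ∂(μ x) := fun x => by
    rw [enorm_Lp_sq]
    exact lintegral_congr_ae ((h1 x).coeFn_toLp.mono fun p hp => by simp only [hp])
  simpa only [h2] using h

theorem lp_ext_ae {f g : lp (fun x => Lp ℂ 2 (μ x)) 2} (h : ∀ x, f x =ᵐ[μ x] g x) : f = g :=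
  lp.ext (funext fun x => Lp.ext (h x))

theorem norm_eq_of_enorm_sq_eq {E F : Type*} [SeminormedAddGroup E] [SeminormedAddGroup F] {a : E}
    {b : F} (h : ‖a‖ₑ ^ 2 = ‖b‖ₑ ^ 2) : ‖a‖ = ‖b‖ := by
  have h1 := congrArg ENNReal.toReal h
  simp only [ENNReal.toReal_pow, toReal_enorm] at h1
  exact (sq_eq_sq₀ (norm_nonneg _) (norm_nonneg _)).1 h1

end SquareSummable

/-! ### Weighted composition operators with scalar weights -/

section WeightedComposition

variable {X Ω : Type*} [MeasurableSpace Ω]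

/-- The operator `f ↦ (Γ_x f_{φ(x)})_x` in `ℓ²({L²(μ_x)})`, with maximal domain. -/
noncomputable def wOp (φ : X → X) (μ : X → Measure Ω) (Γ : X → Ω → ℂ)
    (hΓ : ∀ x, Measurable (Γ x))
    (h : ∀ x, (μ x).withDensity (fun p => ‖Γ x p‖ₑ ^ 2) ≪ μ (φ x)) :
    lp (fun x => Lp ℂ 2 (μ x)) 2 →ₗ.[ℂ] lp (fun x => Lp ℂ 2 (μ x)) 2 :=
  owco (H := fun x => Lp ℂ 2 (μ x)) φ fun x => mulOp (μ (φ x)) (μ x) (Γ x) (hΓ x) (h x)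

variable {φ : X → X} {μ : X → Measure Ω} {Γ : X → Ω → ℂ}

/-- The domain conditions are implied by the values being in `ℓ²({L²(μ_x)})`. -/
theorem mem_graph_wOp {hΓ : ∀ x, Measurable (Γ x)}
    {h : ∀ x, (μ x).withDensity (fun p => ‖Γ x p‖ₑ ^ 2) ≪ μ (φ x)}
    {f g : lp (fun x => Lp ℂ 2 (μ x)) 2} :
    (f, g) ∈ (wOp φ μ Γ hΓ h).graph ↔ ∀ x, g x =ᵐ[μ x] fun p => Γ x p * f (φ x) p := by
  rw [mem_graph_iff_exists]
  constructor
  · rintro ⟨hf, rfl⟩ x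
    exact MemLp.coeFn_toLp (hf.choose x)
  · intro hg
    have h1 : ∀ x, f (φ x) ∈ (mulOp (μ (φ x)) (μ x) (Γ x) (hΓ x) (h x)).domain := fun x =>
      (Lp.memLp (g x)).ae_eq (hg x)
    have h2 : ∀ x, mulOp (μ (φ x)) (μ x) (Γ x) (hΓ x) (h x) ⟨f (φ x), h1 x⟩ = g x := fun x =>
      Lp.ext ((MemLp.coeFn_toLp (h1 x)).trans (hg x).symm)
    refine ⟨⟨h1, ?_⟩, lp.ext (funext fun x => h2 x)⟩
    rw [funext h2]
    exact lp.memℓp g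

theorem exists_continuousLinearMap_of_graph {E F : Type*}
    [NormedAddCommGroup E] [InnerProductSpace ℂ E] [NormedAddCommGroup F] [InnerProductSpace ℂ F]
    {T : E →ₗ.[ℂ] F} (hT : ∀ f, ∃ g, (f, g) ∈ T.graph ∧ ‖g‖ ≤ ‖f‖) :
    ∃ U : E →L[ℂ] F, ∀ f, (f, U f) ∈ T.graph := by
  have hd : ∀ f, f ∈ T.domain := fun f =>
    let ⟨_, hg, _⟩ := hT f
    LinearPMap.mem_domain_of_mem_graph hg
  let L : E →ₗ[ℂ] F := T.toFun.comp (LinearMap.id.codRestrict T.domain hd)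
  have hL : ∀ f, (f, L f) ∈ T.graph := fun f => T.mem_graph ⟨f, hd f⟩
  refine ⟨L.mkContinuous 1 fun f => ?_, hL⟩
  obtain ⟨g, hg, hgf⟩ := hT f
  rwa [one_mul, LinearPMap.mem_graph_snd_inj T (hL f) hg rfl]

/-- The direct sum of multiplications by nonnegative functions is positive and selfadjoint. -/
theorem isSelfAdjoint_wOp_id {s : X → Ω → ℝ} (hs : ∀ x, Measurable fun p => (s x p : ℂ))
    (hs0 : ∀ x p, 0 ≤ s x p)
    (h : ∀ x, (μ x).withDensity (fun p => ‖(s x p : ℂ)‖ₑ ^ 2) ≪ μ (id x)) :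
    IsSelfAdjoint (wOp id μ (fun x p => (s x p : ℂ)) hs h) ∧
      ∀ f : (wOp id μ (fun x p => (s x p : ℂ)) hs h).domain,
        0 ≤ (inner ℂ (wOp id μ (fun x p => (s x p : ℂ)) hs h f)
          (f : lp (fun x => Lp ℂ 2 (μ x)) 2)).re := by
  set P := wOp id μ (fun x p => (s x p : ℂ)) hs h
  have hP : ∀ f : P.domain, ∀ x, P f x =ᵐ[μ x] fun p => (s x p : ℂ) * (f : lp (fun x => Lp ℂ 2 (μ x)) 2) x p :=
    fun f => mem_graph_wOp.1 (P.mem_graph f)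
  have hpos : ∀ f : P.domain, 0 ≤ (inner ℂ (P f) (f : lp (fun x => Lp ℂ 2 (μ x)) 2)).re := by
    intro f
    refine (Complex.hasSum_re (lp.hasSum_inner (P f) (f : lp (fun x => Lp ℂ 2 (μ x)) 2))).nonneg
      fun x => ?_
    have h1 : inner ℂ (P f x) ((f : lp (fun x => Lp ℂ 2 (μ x)) 2) x) =
        ∫ p, ((s x p * ‖(f : lp (fun x => Lp ℂ 2 (μ x)) 2) x p‖ ^ 2 : ℝ) : ℂ) ∂(μ x) := by
      rw [L2.inner_def]
      refine integral_congr_ae ((hP f x).mono fun p hp => ?_)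
      simp only [hp, RCLike.inner_apply, map_mul, Complex.conj_ofReal]
      push_cast
      rw [← Complex.mul_conj']
      ring
    rw [h1, integral_complex_ofReal, Complex.ofReal_re]
    exact integral_nonneg fun p => mul_nonneg (hs0 x p) (sq_nonneg _)
  refine ⟨isSelfAdjoint_of_surjective_add_one (fun f g => ?_) hpos fun g => ?_, hpos⟩
  · rw [lp.inner_eq_tsum, lp.inner_eq_tsum]
    refine tsum_congr fun x => ?_
    rw [L2.inner_def, L2.inner_def]
    refine integral_congr_ae ?_
    filter_upwards [hP f x, hP g x] with p h1 h2
    simp only [h1, h2, RCLike.inner_apply, map_mul, Complex.conj_ofReal]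
    ring
  · -- the solution of `P f + f = g` is `f_x = g_x / (1 + s_x)`
    have hsm : ∀ x, Measurable fun p => ((1 + s x p)⁻¹ : ℂ) := fun x =>
      (measurable_const.add (hs x)).inv
    have hgm : ∀ x, AEStronglyMeasurable (g x) (μ x) := fun x => Lp.aestronglyMeasurable _
    have hle : ∀ c : X → Ω → ℂ, (∀ x p, ‖c x p‖ ≤ 1) →
        ∑' x, ∫⁻ p, ‖c x p * g x p‖ₑ ^ 2 ∂(μ x) ≠ ∞ := fun c hc => by
      refine ne_top_of_le_ne_top (b := ‖g‖ₑ ^ 2) (by simp) ?_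
      rw [enorm_sq_eq_tsum_lintegral]
      refine ENNReal.tsum_le_tsum fun x => lintegral_mono fun p => ?_
      gcongr
      rw [enorm_mul]
      refine mul_le_of_le_one_left' ?_
      rw [← ofReal_norm]
      exact ENNReal.ofReal_le_one.2 (hc x p)
    have hn : ∀ x p, ‖(1 + s x p : ℂ)‖ = 1 + s x p := fun x p => by
      rw [← Complex.ofReal_one, ← Complex.ofReal_add, Complex.norm_real, Real.norm_of_nonneg]
      linarith [hs0 x p]
    obtain ⟨f, hf⟩ := exists_lp_ae_eq (μ := μ) (F := fun x p => (1 + s x p : ℂ)⁻¹ * g x p)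
      (fun x => (hsm x).aestronglyMeasurable.mul (hgm x)) (hle _ fun x p => by
        rw [norm_inv, hn]
        exact inv_le_one_of_one_le₀ (by linarith [hs0 x p]))
    obtain ⟨k, hk⟩ := exists_lp_ae_eq (μ := μ)
      (F := fun x p => ((s x p : ℂ) * (1 + s x p : ℂ)⁻¹) * g x p)
      (fun x => ((hs x).mul (hsm x)).aestronglyMeasurable.mul (hgm x)) (hle _ fun x p => by
        rw [norm_mul, norm_inv, hn, Complex.norm_real, Real.norm_of_nonneg (hs0 x p),
          ← div_eq_mul_inv]
        exact div_le_one_of_le₀ (by linarith) (by linarith [hs0 x p]))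
    have hfk : (f, k) ∈ P.graph := mem_graph_wOp.2 fun x => by
      filter_upwards [hf x, hk x] with p h1 h2
      rw [h2, id_eq, h1]
      ring
    obtain ⟨hfd, rfl⟩ := mem_graph_iff_exists.1 hfk
    refine ⟨⟨f, hfd⟩, lp_ext_ae fun x => ?_⟩
    filter_upwards [hf x, hk x, Lp.coeFn_add (P ⟨f, hfd⟩ x) (f x)] with p h1 h2 h3
    have h4 : (1 + s x p : ℂ) ≠ 0 := by
      rw [← norm_ne_zero_iff, hn]
      linarith [hs0 x p]
    rw [lp.coeFn_add, Pi.add_apply, h3, Pi.add_apply, h1, h2]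
    field_simp
    ring

end WeightedComposition

/-! ### The summed Radon-Nikodym derivatives over the fibres of `φ` -/

section FiberDeriv

variable {X Ω : Type*} [MeasurableSpace Ω]

/-- `∑_{y ∈ φ⁻¹({x})} d(|Γ_y|² μ_y) / dμ_x`. -/
noncomputable def fiberDeriv (φ : X → X) (μ : X → Measure Ω) (Γ : X → Ω → ℂ) (x : X) (p : Ω) :
    ℝ≥0∞ :=
  ∑' y : φ ⁻¹' {x}, ((μ y).withDensity fun p => ‖Γ y p‖ₑ ^ 2).rnDeriv (μ x) p

variable {φ : X → X} {μ : X → Measure Ω} {Γ : X → Ω → ℂ}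

theorem measurable_fiberDeriv [Countable X] (x : X) : Measurable (fiberDeriv φ μ Γ x) :=
  Measurable.tsum fun _ => Measure.measurable_rnDeriv _ _

/-- Change of variables: summing over the fibres of `φ` turns the weights `|Γ_x|²` into the
densities `fiberDeriv`. -/
theorem tsum_lintegral_mul_weight [Countable X] [∀ x, SigmaFinite (μ x)]
    (hΓ : ∀ x, Measurable (Γ x))
    (h : ∀ x, (μ x).withDensity (fun p => ‖Γ x p‖ₑ ^ 2) ≪ μ (φ x))
    {F : X → Ω → ℝ≥0∞} (hF : ∀ x, Measurable (F x)) :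
    ∑' x, ∫⁻ p, ‖Γ x p‖ₑ ^ 2 * F (φ x) p ∂(μ x) =
      ∑' z, ∫⁻ p, fiberDeriv φ μ Γ z p * F z p ∂(μ z) := by
  have h1 : ∀ z, ∫⁻ p, fiberDeriv φ μ Γ z p * F z p ∂(μ z) =
      ∑' y : φ ⁻¹' {z}, ∫⁻ p, ‖Γ y p‖ₑ ^ 2 * F z p ∂(μ y) := fun z => by
    simp_rw [fiberDeriv, ← ENNReal.tsum_mul_right]
    rw [lintegral_tsum (f := fun (y : φ ⁻¹' {z}) p =>
      ((μ y).withDensity fun p => ‖Γ y p‖ₑ ^ 2).rnDeriv (μ z) p * F z p)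
      fun y => ((Measure.measurable_rnDeriv _ _).mul (hF z)).aemeasurable]
    refine tsum_congr fun y => ?_
    have hy : φ y = z := y.2
    have hm : Measurable fun p => ‖Γ y p‖ₑ ^ 2 := by have := hΓ y; fun_prop
    rw [lintegral_rnDeriv_mul (by simpa only [hy] using h y) (hF z).aemeasurable,
      lintegral_withDensity_eq_lintegral_mul _ hm (hF z)]
    rfl
  simp_rw [h1]
  rw [← (Equiv.sigmaFiberEquiv φ).tsum_eq, ENNReal.tsum_sigma']
  refine tsum_congr fun z => tsum_congr fun y => ?_
  have hy : φ y = z := y.2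
  simp only [Equiv.sigmaFiberEquiv, Equiv.coe_fn_mk, hy]

end FiberDeriv

/-! ### The quasinormality criterion -/

section Criterion

variable {X Ω : Type*} [MeasurableSpace Ω] {φ : X → X} {μ : X → Measure Ω} {Γ : X → Ω → ℂ}

/-- If `G_x < ∞` and `Γ_x G_{φ(x)} = Γ_x G_x` almost everywhere, where `G_x = fiberDeriv φ μ Γ x`,
then `wOp φ μ Γ` is quasinormal. Its modulus is multiplication by `√G_x` in the coordinate `x`, and
the partial isometry is `wOp` with weights `Γ_x / √G_{φ(x)}` (read as `0` where the denominator
vanishes). -/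
theorem isQuasinormal_wOp [Countable X] [∀ x, SigmaFinite (μ x)] (hΓ : ∀ x, Measurable (Γ x))
    (h : ∀ x, (μ x).withDensity (fun p => ‖Γ x p‖ₑ ^ 2) ≪ μ (φ x))
    (hfin : ∀ x, ∀ᵐ p ∂(μ x), fiberDeriv φ μ Γ x p < ∞)
    (hG : ∀ x, ∀ᵐ p ∂(μ x), Γ x p * ((fiberDeriv φ μ Γ (φ x) p).toReal : ℂ) =
      Γ x p * ((fiberDeriv φ μ Γ x p).toReal : ℂ)) :
    IsQuasinormal (wOp φ μ Γ hΓ h) := by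
  set G : X → Ω → ℝ≥0∞ := fiberDeriv φ μ Γ with hGdef
  have hGm : ∀ x, Measurable (G x) := measurable_fiberDeriv
  have hn2 : ∀ x, Measurable fun p => ‖Γ x p‖ₑ ^ 2 := fun x => by have := hΓ x; fun_prop
  set s : X → Ω → ℝ := fun x p => √(G x p).toReal with hs
  have hsm : ∀ x, Measurable fun p => (s x p : ℂ) := fun x =>
    Complex.measurable_ofReal.comp (hGm x).ennreal_toReal.sqrt
  have hs2 : ∀ x p, G x p ≠ ∞ → ‖(s x p : ℂ)‖ₑ ^ 2 = G x p := fun x p hp => by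
    rw [← ofReal_norm, Complex.norm_real, Real.norm_of_nonneg (Real.sqrt_nonneg _),
      ← ENNReal.ofReal_pow (Real.sqrt_nonneg _), Real.sq_sqrt ENNReal.toReal_nonneg,
      ENNReal.ofReal_toReal hp]
  -- where `Γ_x ≠ 0`, the function `G_{φ(x)}` is neither `∞` nor `0`
  have hne_top : ∀ x, ∀ᵐ p ∂(μ x), Γ x p ≠ 0 → G (φ x) p ≠ ∞ := fun x => by
    filter_upwards [(ae_withDensity_iff (hn2 x)).1 ((h x).ae_le (hfin (φ x)))] with p hp h0
    exact (hp (by simpa using h0)).ne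
  have hne_zero : ∀ x, ∀ᵐ p ∂(μ x), Γ x p ≠ 0 → G (φ x) p ≠ 0 := fun x => by
    have hF : ∀ z, Measurable ((G z ⁻¹' {0}).indicator (1 : Ω → ℝ≥0∞)) := fun z =>
      measurable_one.indicator (hGm z (measurableSet_singleton 0))
    have h1 := tsum_lintegral_mul_weight hΓ h hF
    have h2 : ∀ z p, G z p * (G z ⁻¹' {0}).indicator (1 : Ω → ℝ≥0∞) p = 0 := fun z p => by
      by_cases hz : G z p = 0 <;> simp [hz]
    simp only [← hGdef, h2, lintegral_zero, tsum_zero, ENNReal.tsum_eq_zero] at h1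
    filter_upwards [(lintegral_eq_zero_iff ((hn2 x).mul (hF (φ x)))).1 (h1 x)] with p hp h0 hz
    simp [hz, h0] at hp
  -- the weights of the partial isometry; `0⁻¹ = 0` makes them vanish where `G_{φ(x)} = 0`
  set u : X → Ω → ℂ := fun x p => Γ x p * (s (φ x) p : ℂ)⁻¹ with hu
  have hum : ∀ x, Measurable (u x) := fun x => (hΓ x).mul (hsm _).inv
  have hu_mul : ∀ x, ∀ᵐ p ∂(μ x), u x p * (s (φ x) p : ℂ) = Γ x p := fun x => by
    filter_upwards [hne_top x, hne_zero x] with p h1 h2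
    by_cases h0 : Γ x p = 0
    · simp [hu, h0]
    · have h3 : (s (φ x) p : ℂ) ≠ 0 := by
        rw [Complex.ofReal_ne_zero]
        exact (Real.sqrt_pos.2 (ENNReal.toReal_pos (h2 h0) (h1 h0))).ne'
      simp only [hu]
      field_simp
  -- this is where the hypothesis `Γ_x G_{φ(x)} = Γ_x G_x` enters; it gives `U P ⊆ P U`
  have hmul_u : ∀ x, ∀ᵐ p ∂(μ x), (s x p : ℂ) * u x p = Γ x p := fun x => by
    filter_upwards [hG x, hu_mul x] with p h1 h2
    by_cases h0 : Γ x p = 0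
    · simp [hu, h0]
    · have h3 : s x p = s (φ x) p := by
        have := Complex.ofReal_injective (mul_left_cancel₀ h0 h1)
        simp only [hs, this]
      rw [h3, mul_comm, h2]
  have hs_ac : ∀ x, (μ x).withDensity (fun p => ‖(s x p : ℂ)‖ₑ ^ 2) ≪ μ (id x) := fun x =>
    withDensity_absolutelyContinuous _ _
  have hu_ac : ∀ x, (μ x).withDensity (fun p => ‖u x p‖ₑ ^ 2) ≪ μ (φ x) := fun x => by
    have h1 : (fun p => ‖u x p‖ₑ ^ 2) =
        (fun p => ‖Γ x p‖ₑ ^ 2) * fun p => ‖(s (φ x) p : ℂ)⁻¹‖ₑ ^ 2 := by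
      funext p
      simp only [hu, enorm_mul, mul_pow, Pi.mul_apply]
    have h2 : Measurable fun p => ‖(s (φ x) p : ℂ)⁻¹‖ₑ ^ 2 := by
      have := (hsm (φ x)).inv
      fun_prop
    rw [h1, withDensity_mul _ (hn2 x) h2]
    exact (withDensity_absolutelyContinuous _ _).trans (h x)
  have hfm : ∀ (f : lp (fun x => Lp ℂ 2 (μ x)) 2) x, Measurable (f x) := fun f x =>
    (Lp.stronglyMeasurable (f x)).measurable
  -- `∑ ‖Γ_x f_{φ(x)}‖² = ∑ ‖√G_x f_x‖²`
  have hnorm : ∀ f : lp (fun x => Lp ℂ 2 (μ x)) 2,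
      ∑' x, ∫⁻ p, ‖Γ x p * f (φ x) p‖ₑ ^ 2 ∂(μ x) =
        ∑' x, ∫⁻ p, ‖(s x p : ℂ) * f x p‖ₑ ^ 2 ∂(μ x) := fun f => by
    have h1 := tsum_lintegral_mul_weight hΓ h (F := fun z p => ‖f z p‖ₑ ^ 2) fun z => by
      have := hfm f z
      fun_prop
    simp_rw [enorm_mul, mul_pow]
    rw [h1]
    refine tsum_congr fun z => lintegral_congr_ae ?_
    filter_upwards [hfin z] with p hp
    rw [hs2 z p hp.ne]
  -- `∑ ‖u_x f_{φ(x)}‖² = ∑ ∫ G_z |f_z|² / G_z ≤ ‖f‖²`, so `U` is bounded and defined everywhere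
  have hU_ex : ∀ f, ∃ g, (f, g) ∈ (wOp φ μ u hum hu_ac).graph ∧ ‖g‖ ≤ ‖f‖ := fun f => by
    have h1 := tsum_lintegral_mul_weight hΓ h
      (F := fun z p => ‖(s z p : ℂ)⁻¹ * f z p‖ₑ ^ 2) fun z => by
        have := hfm f z
        have := hsm z
        fun_prop
    have h2 : ∑' x, ∫⁻ p, ‖u x p * f (φ x) p‖ₑ ^ 2 ∂(μ x) ≤ ‖f‖ₑ ^ 2 := by
      simp_rw [hu, mul_assoc, enorm_mul (Γ _ _), mul_pow]
      rw [h1, enorm_sq_eq_tsum_lintegral]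
      refine ENNReal.tsum_le_tsum fun z => lintegral_mono_ae ?_
      filter_upwards [hfin z] with p hp
      rw [← hGdef, ← hs2 z p hp.ne, ← mul_pow, ← enorm_mul, ← mul_assoc]
      gcongr
      rw [enorm_mul]
      refine mul_le_of_le_one_left' ?_
      by_cases h0 : (s z p : ℂ) = 0
      · simp [h0]
      · simp [mul_inv_cancel₀ h0]
    obtain ⟨g, hg⟩ := exists_lp_ae_eq (μ := μ) (F := fun x p => u x p * f (φ x) p)
      (fun x => ((hum x).mul (hfm f (φ x))).aestronglyMeasurable)
      (ne_top_of_le_ne_top (by simp) h2)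
    refine ⟨g, mem_graph_wOp.2 hg, ?_⟩
    rw [← enorm_sq_eq_of_ae hg] at h2
    exact enorm_le_iff_norm_le.1 ((ENNReal.pow_le_pow_left_iff two_ne_zero).1 h2)
  obtain ⟨U, hU⟩ := exists_continuousLinearMap_of_graph hU_ex
  replace hU : ∀ f x, U f x =ᵐ[μ x] fun p => u x p * f (φ x) p := fun f =>
    mem_graph_wOp.1 (hU f)
  obtain ⟨hP, hPpos⟩ := isSelfAdjoint_wOp_id (μ := μ) hsm (fun _ _ => Real.sqrt_nonneg _) hs_ac
  set P := wOp id μ (fun x p => (s x p : ℂ)) hsm hs_ac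
  have hUP : ∀ f k, (f, k) ∈ P.graph → ∀ x, U k x =ᵐ[μ x] fun p => Γ x p * f (φ x) p := by
    intro f k hk x
    filter_upwards [hU k x, mul_ae_congr (hum x) (hu_ac x) (mem_graph_wOp.1 hk (φ x)), hu_mul x]
      with p h1 h2 h3
    rw [h1, h2, id_eq, ← mul_assoc, h3]
  -- the two domains agree by `hnorm`
  have hA : wOp φ μ Γ hΓ h = pcomp (ofBounded U) P := by
    refine ext_graph fun f g => ?_
    rw [mem_graph_ofBounded_pcomp, mem_graph_wOp]
    constructor
    · intro hg
      obtain ⟨k, hk⟩ := exists_lp_ae_eq (μ := μ) (F := fun x p => (s x p : ℂ) * f x p)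
        (fun x => ((hsm x).mul (hfm f x)).aestronglyMeasurable)
        (by rw [← hnorm, ← enorm_sq_eq_of_ae hg]; simp)
      have hk' : (f, k) ∈ P.graph := mem_graph_wOp.2 hk
      exact ⟨k, hk', lp_ext_ae fun x => (hUP f k hk' x).trans (hg x).symm⟩
    · rintro ⟨k, hk, rfl⟩
      exact hUP f k hk
  -- `u_x` and `Γ_x` have the same zeros, so `U` has the kernel of `wOp φ μ Γ`
  have hu_zero : ∀ x, ∀ᵐ p ∂(μ x), ∀ c : ℂ, u x p * c = 0 ↔ Γ x p * c = 0 := fun x => by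
    filter_upwards [hu_mul x] with p hp c
    constructor <;> intro h0
    · rw [← hp, mul_right_comm, h0, zero_mul]
    · simp only [hu]
      rw [mul_right_comm, h0, zero_mul]
  have hU_zero : ∀ f, U f = 0 ↔ (f, 0) ∈ (wOp φ μ Γ hΓ h).graph := fun f => by
    rw [mem_graph_wOp]
    constructor
    · intro h0 x
      filter_upwards [hU f x, hu_zero x, Lp.coeFn_zero ℂ 2 (μ x)] with p h1 h2 h3
      rw [h0] at h1
      exact h3.trans ((h2 _).1 (h1.symm.trans h3)).symm
    · intro h0
      refine lp_ext_ae fun x => ?_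
      filter_upwards [hU f x, hu_zero x, Lp.coeFn_zero ℂ 2 (μ x), h0 x] with p h1 h2 h3 h4
      exact (h1.trans ((h2 _).2 (h4.symm.trans h3))).trans h3.symm
  rw [hA] at hU_zero ⊢
  refine isQuasinormal_ofBounded_pcomp hP hPpos (fun f k hk => norm_eq_of_enorm_sq_eq ?_)
    (fun f hf => (hU_zero f).1 hf)
    (fun f hf => (hU_zero f).2 (mem_graph_ofBounded_pcomp.2 ⟨0, hf, map_zero U⟩))
    fun f k hk => mem_graph_wOp.2 fun x => ?_
  · rw [enorm_sq_eq_of_ae (hUP f k hk), hnorm, enorm_sq_eq_of_ae (mem_graph_wOp.1 hk)]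
    rfl
  · filter_upwards [hUP f k hk x, hU f x, hmul_u x] with p h1 h2 h3
    rw [h1, id_eq, h2, ← mul_assoc, h3]

end Criterion

/-! ### The embedding by functions that do not depend on the second variable -/

section Embedding

variable {X W S : Type*} [MeasurableSpace W] [MeasurableSpace S]

theorem sigmaFinite_hatMeasure (ρ : Measure W) [SigmaFinite ρ] (ϑ : X → Kernel W S)
    [∀ x, IsMarkovKernel (ϑ x)] (x : X) : SigmaFinite (hatMeasure ρ ϑ x) := by
  have h : (hatMeasure ρ ϑ x).map Prod.fst = ρ := Measure.fst_compProd ρ (ϑ x)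
  exact SigmaFinite.of_map _ measurable_fst.aemeasurable (by rwa [h])

/-- The isometry `(Q f)_x(w, s) = f_x(w)`; it exists since the first marginal of each
`hatMeasure ρ ϑ x` is `ρ`. -/
theorem exists_linearIsometry_comp_fst (ρ : Measure W) [SigmaFinite ρ] (ϑ : X → Kernel W S)
    [∀ x, IsMarkovKernel (ϑ x)] :
    ∃ Q : lp (fun _ : X => Lp ℂ 2 ρ) 2 →ₗᵢ[ℂ] lp (fun x : X => Lp ℂ 2 (hatMeasure ρ ϑ x)) 2,
      ∀ f x, (Q f x : W × S → ℂ) =ᵐ[hatMeasure ρ ϑ x] fun p => (f x : W → ℂ) p.1 := by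
  have hmp : ∀ x, MeasurePreserving Prod.fst (hatMeasure ρ ϑ x) ρ := fun x =>
    ⟨measurable_fst, Measure.fst_compProd ρ (ϑ x)⟩
  let q : ∀ x, Lp ℂ 2 ρ →ₗᵢ[ℂ] Lp ℂ 2 (hatMeasure ρ ϑ x) := fun x =>
    Lp.compMeasurePreservingₗᵢ ℂ Prod.fst (hmp x)
  have hq : ∀ (f : lp (fun _ : X => Lp ℂ 2 ρ) 2) x, ‖q x (f x)‖ₑ = ‖f x‖ₑ := fun f x => by
    rw [← ofReal_norm, ← ofReal_norm, (q x).norm_map]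
  let Q : lp (fun _ : X => Lp ℂ 2 ρ) 2 →ₗᵢ[ℂ] lp (fun x : X => Lp ℂ 2 (hatMeasure ρ ϑ x)) 2 :=
    { toFun := fun f => ⟨fun x => q x (f x), memℓp_two_iff.2 (by
        simp_rw [hq]
        rw [← enorm_lp_sq]
        simp)⟩
      map_add' := fun f g => lp.ext (funext fun x => map_add (q x) (f x) (g x))
      map_smul' := fun c f => lp.ext (funext fun x => map_smul (q x) c (f x))
      norm_map' := fun f => norm_eq_of_enorm_sq_eq (by
        rw [enorm_lp_sq, enorm_lp_sq]
        exact tsum_congr fun x => congrArg (· ^ 2) (hq f x)) }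
  exact ⟨Q, fun f x => Lp.coeFn_compMeasurePreserving (f x) (hmp x)⟩

theorem extendsAlong_hatOp (φ : X → X) (ρ : Measure W) [SigmaFinite ρ] (lam : X → W → ℂ)
    (hlam : ∀ x, Measurable (lam x)) (ϑ : X → Kernel W S) [∀ x, IsMarkovKernel (ϑ x)]
    (hB : ∀ x w, (‖lam x w‖ₑ ^ 2) • ϑ x w ≪ ϑ (φ x) w)
    {Q : lp (fun _ : X => Lp ℂ 2 ρ) 2 →ₗᵢ[ℂ] lp (fun x : X => Lp ℂ 2 (hatMeasure ρ ϑ x)) 2}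
    (hQ : ∀ f x, (Q f x : W × S → ℂ) =ᵐ[hatMeasure ρ ϑ x] fun p => (f x : W → ℂ) p.1) :
    ExtendsAlong Q (baseOp φ ρ lam hlam) (hatOp φ ρ lam hlam ϑ hB) := by
  intro f
  have hf : ∀ x, _ =ᵐ[ρ] _ := (mem_graph_wOp (μ := fun _ => ρ) (hΓ := hlam)
    (h := fun x => withDensity_absolutelyContinuous _ _)).1 ((baseOp φ ρ lam hlam).mem_graph f)
  refine mem_graph_iff_exists.1 ((mem_graph_wOp (μ := hatMeasure ρ ϑ)
    (hΓ := measurable_hatWeight hlam)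
    (h := weightedMeasure_absolutelyContinuous φ ρ hlam ϑ hB)).2 fun x => ?_)
  have hmp : MeasurePreserving Prod.fst (hatMeasure ρ ϑ x) ρ :=
    ⟨measurable_fst, Measure.fst_compProd ρ (ϑ x)⟩
  have h1 := hmp.quasiMeasurePreserving.ae (hf x)
  have h2 := mul_ae_congr (measurable_hatWeight (S := S) hlam x)
    (weightedMeasure_absolutelyContinuous φ ρ hlam ϑ hB x) (hQ f (φ x))
  filter_upwards [h1, h2, hQ (baseOp φ ρ lam hlam f) x] with p h3 h4 h5
  rw [h5, h4, h3]
  rfl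

end Embedding

end OWCO

theorem mainTheorem1 {X : Type u} [Countable X] (φ : X → X)
    {W : Type v} [MeasurableSpace W] (ρ : Measure W) [SigmaFinite ρ]
    (lam : X → W → ℂ) (hlam : ∀ x, Measurable (lam x))
    {S : Type w} [MeasurableSpace S]
    (ϑ : X → Kernel W S) [∀ x, IsMarkovKernel (ϑ x)]
    (hB : ∀ x w, (‖lam x w‖ₑ ^ 2) • ϑ x w ≪ ϑ (φ x) w)
    (hfin : ∀ x, ∀ᵐ p ∂(OWCO.hatMeasure ρ ϑ x), OWCO.gFun φ ρ lam ϑ x p < ∞)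
    (hG : ∀ x, ∀ᵐ p ∂(OWCO.hatMeasure ρ ϑ x),
      lam x p.1 * ((OWCO.gFun φ ρ lam ϑ (φ x) p).toReal : ℂ) =
        lam x p.1 * ((OWCO.gFun φ ρ lam ϑ x p).toReal : ℂ)) :
    OWCO.IsQuasinormal (OWCO.hatOp φ ρ lam hlam ϑ hB) ∧
    (∃ Q : lp (fun _ : X => Lp ℂ 2 ρ) 2 →ₗᵢ[ℂ] lp (fun x : X => Lp ℂ 2 (OWCO.hatMeasure ρ ϑ x)) 2,
      (∀ f x, (Q f x : W × S → ℂ) =ᵐ[OWCO.hatMeasure ρ ϑ x] fun p => (f x : W → ℂ) p.1) ∧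
      OWCO.ExtendsAlong Q (OWCO.baseOp φ ρ lam hlam) (OWCO.hatOp φ ρ lam hlam ϑ hB)) ∧
    OWCO.HasNormalExtension.{max u v w} (OWCO.baseOp φ ρ lam hlam) ∧
    (Dense ((OWCO.baseOp φ ρ lam hlam).domain : Set (lp (fun _ : X => Lp ℂ 2 ρ) 2)) →
      OWCO.IsSubnormal.{max u v w} (OWCO.baseOp φ ρ lam hlam)) := by
  have hσ := OWCO.sigmaFinite_hatMeasure (X := X) ρ ϑ
  have hq : OWCO.IsQuasinormal (OWCO.hatOp φ ρ lam hlam ϑ hB) :=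
    OWCO.isQuasinormal_wOp (μ := OWCO.hatMeasure ρ ϑ) (OWCO.measurable_hatWeight hlam)
      (OWCO.weightedMeasure_absolutelyContinuous φ ρ hlam ϑ hB) hfin hG
  obtain ⟨Q, hQ⟩ := OWCO.exists_linearIsometry_comp_fst (X := X) ρ ϑ
  have hQe := OWCO.extendsAlong_hatOp φ ρ lam hlam ϑ hB hQ
  obtain ⟨J, N, hN, hJ⟩ := hq.exists_normal_extension
  have hext : OWCO.HasNormalExtension.{max u v w} (OWCO.baseOp φ ρ lam hlam) := by
    refine ⟨_, inferInstance, inferInstance, inferInstance, J.comp Q, N, hN, fun f => ?_⟩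
    obtain ⟨h1, h2⟩ := hQe f
    obtain ⟨h3, h4⟩ := hJ ⟨Q f, h1⟩
    exact ⟨h3, h4.trans (congrArg J h2)⟩
  exact ⟨hq, ⟨Q, hQ, hQe⟩, hext, fun hd => ⟨hd, hext⟩⟩
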